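/- Let $\Gamma$ be a finite set of colors. A \emph{colored interval partition} of a nonempty word $u\in\Gamma^*$ is a factorization $u=u_1\cdots u_q$ into nonempty words (blocks) together with a word $w=w(1)\cdots w(q)\in\Gamma^*$ (the colors of the blocks), such that a block $u_k$ of length one has the color of its letter, $w(k)=u_k$. Let $\mathcal H$ be the free unital associative $\mathbb C$-algebra on symbols $Y_u^i$ ($i\in\Gamma$, $u\in\Gamma^*$, $|u|\ge 2$), and put $Y_j^i=\delta_{ij}1$ for $i,j\in\Gamma$. Let $\Delta:\mathcal H\to\mathcal H\otimes\mathcal H$ and $\varepsilon:\mathcal H\to\mathbb C$ be the algebra homomorphisms with $$\Delta(Y_u^i)=\sum_{((u_1,\dots,u_q),w)}Y_{u_1}^{w(1)}\cdots Y_{u_q}^{w(q)}\otimes Y_w^i,\qquad \varepsilon(Y_u^i)=0\qquad(|u|\ge2),$$ where the sum runs over all colored interval partitions of $u$ (this is the incidence bialgebra of colored interval partitions). Then there is exactly one linear map $S_{\mathcal H}:\mathcal H\to\mathcal H$ with $m(S_{\mathcal H}\otimes I)\Delta=m(I\otimes S_{\mathcal H})\Delta=\eta\varepsilon$ (the antipode),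 and for every nonempty word $v\in\Gamma^*$ and every $j\in\Gamma$ the set $\mathbf{OST}_v^j$ defined below is finite and $$S_{\mathcal H}(Y_v^j)=\sum_{E\in\mathbf{OST}_v^j}(-1)^{\ell(E)}\,\Omega(E).$$ Here a \emph{layered colored tree} is a finite planar rooted tree with vertices colored by $\Gamma$, in which all leaves lie on the same (lowest) level and the only offspring of a unary vertex has the color of its parent; trees are taken up to isomorphism. A vertex is \emph{non-degenerate} if it has more than one offspring. The tree is \emph{proper} if every non-leaf level contains a non-degenerate vertex, and \emph{simple} if no level contains more than one. It is \emph{order contractible} at a non-degenerate vertex $x$ that is not the root if the parent $x'$ of $x$ is unary, no non-degenerate vertex lies to the right of $x$ on the level of $x$, and no non-degenerate vertex lies to the left of $x'$ on the level of $x'$. It is \emph{order reduced} if it is order contractible at no vertex. $\mathbf{OST}_v^j$ is the set of all proper, simple, order-reduced layered colored trees whose root has color $j$ and whose leaves, from left to right, have the colors $v$. The number of layers $\ell(E)$ is the number of non-leaf levels of $E$. Finally $\Omega(E)=Y(x_1)\cdots Y(x_k)$, where $x_1,\dots,x_k$ are the non-degenerate vertices of $E$ listed from the lowest level to the highest and from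 left to right within each level, and $Y(x)=Y_u^i$ if $x$ has color $i$ and its offspring, from left to right, have the colors $u$. -/

import Mathlib

open scoped TensorProduct

noncomputable section

namespace IntervalHopf

/-! ### Layers, i.e. colored ordered partitions -/

/-- A colored branch: a root and its ordered offspring, all of them colored by `Γ`.
It is also a colored block: `leaves` is the word of colors of the points of the block,
`root` is the color of the block. -/
structure Branch (Γ : Type*) where
  root : Γ
  leaves : List Γ

namespace Branch

variable {Γ : Type*}

/-- The root has at least one offspring, and an only offspring has the color of its parent. -/
def Valid (b : Branch Γ) : Prop :=
  b.leaves ≠ [] ∧ ∀ c, b.leaves = [c] → b.root = c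

/-- The root is unary: it has precisely one offspring. -/
def Unary (b : Branch Γ) : Prop := b.leaves.length = 1

/-- The root is non-degenerate: it has more than one offspring. -/
def Nondegenerate (b : Branch Γ) : Prop := 2 ≤ b.leaves.length

end Branch

/-- A colored layer (one-layer planar forest): its branches from left to right. Equivalently, a
colored ordered partition, given by its blocks from left to right. -/
abbrev Layer (Γ : Type*) := List (Branch Γ)

namespace Layer

variable {Γ : Type*}

/-- The word of colors of the roots, from left to right. -/
def roots (L : Layer Γ) : List Γ := L.map Branch.root

/-- The word of colors of the leaves, from left to right. -/
def leaves (L : Layer Γ) : List Γ := L.flatMap Branch.leaves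

end Layer

/-- `coloredPartitions u` is the set of colored ordered partitions of the colored ordered set
`(1, …, |u|)` with coloring `u`: the blocks are nonempty, their concatenation is `u`, and a
singleton block has the color of its element. -/
def coloredPartitions {Γ : Type*} (u : List Γ) : Set (Layer Γ) :=
  {L | (∀ b ∈ L, b.Valid) ∧ L.leaves = u}

theorem coloredPartitions_finite {Γ : Type*} [Finite Γ] (u : List Γ) :
    (coloredPartitions u).Finite := by
  classical
  suffices h : ∀ n : ℕ, ∀ u : List Γ, u.length ≤ n → (coloredPartitions u).Finite from
    h u.length u le_rfl
  intro n
  induction n with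
  | zero =>
    intro u hu
    refine (Set.finite_singleton ([] : Layer Γ)).subset ?_
    rintro L ⟨hL, hLu⟩
    cases L with
    | nil => rfl
    | cons b L =>
      have := List.length_pos_iff.2 (hL b (by simp)).1
      simp only [Layer.leaves, List.flatMap_cons] at hLu
      have := congrArg List.length hLu
      simp at this
      omega
  | succ n ih =>
    intro u hu
    refine ((Set.finite_singleton ([] : Layer Γ)).union
      (Set.finite_iUnion fun k : Fin u.length => Set.finite_iUnion fun c : Γ =>
        (ih (u.drop (k + 1)) (by simp; omega)).image
          fun L : Layer Γ => (⟨c, u.take (k + 1)⟩ : Branch Γ) :: L)).subset ?_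
    rintro L ⟨hL, hLu⟩
    cases L with
    | nil => exact Or.inl rfl
    | cons b L =>
      right
      have hb := List.length_pos_iff.2 (hL b (by simp)).1
      simp only [Layer.leaves, List.flatMap_cons] at hLu
      have hlen := congrArg List.length hLu
      simp only [List.length_append] at hlen
      obtain ⟨c, w⟩ := b
      simp only at hb hLu hlen
      have e : w.length - 1 + 1 = w.length := by omega
      simp only [Set.mem_iUnion]
      refine ⟨⟨w.length - 1, by omega⟩, c, L, ⟨fun b hb => hL b (by simp [hb]), ?_⟩, ?_⟩
      · simp [e, ← hLu, Layer.leaves]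
      · simp [e, ← hLu]

/-! ### The Hopf algebra of colored interval partitions -/

/-- The index set of the free generators `Y_u^i`, `|u| ≥ 2`. -/
abbrev Generator (Γ : Type*) := {p : List Γ × Γ // 2 ≤ p.1.length}

/-- The underlying algebra: the free unital algebra on the `Y_u^i` with `|u| ≥ 2`. -/
abbrev H (Γ : Type*) := FreeAlgebra ℂ (Generator Γ)

open Classical in
/-- The element `Y_u^i`, with the convention `Y_j^i = δ_{ij} 1` for words of length one
(and the irrelevant value `0` for the empty word). -/
def Y {Γ : Type*} (u : List Γ) (i : Γ) : H Γ :=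
  if h : 2 ≤ u.length then FreeAlgebra.ι ℂ (⟨(u, i), h⟩ : Generator Γ)
  else if u = [i] then 1 else 0

/-- The class of the segment from the finest partition to the colored partition
`π = (C_1, …, C_q)` with colors `w`, namely `Y_{u|C_1}^{w(1)} ⋯ Y_{u|C_q}^{w(q)}`. -/
def blockProd {Γ : Type*} (π : Layer Γ) : H Γ :=
  (π.map fun b => Y b.leaves b.root).prod

/-- The coproduct: the algebra homomorphism with
`Δ(Y_u^i) = ∑_π Y_{u|C_1}^{w(1)} ⋯ Y_{u|C_q}^{w(q)} ⊗ Y_w^i`, summed over all colored ordered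
partitions `π = ((C_1, …, C_q), w)` of the colored set `u`. (If `π` has just one block, and its
color is not `i`, then the term is zero.) -/
def comul (Γ : Type*) [Finite Γ] : H Γ →ₐ[ℂ] H Γ ⊗[ℂ] H Γ :=
  FreeAlgebra.lift ℂ fun g : Generator Γ =>
    ∑ π ∈ (coloredPartitions_finite g.1.1).toFinset, blockProd π ⊗ₜ[ℂ] Y π.roots g.1.2

/-- The counit: the algebra homomorphism that vanishes on all `Y_u^i` with `|u| ≥ 2`. -/
def counit (Γ : Type*) : H Γ →ₐ[ℂ] ℂ :=
  FreeAlgebra.lift ℂ fun _ : Generator Γ => 0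

/-- `S` is a (two-sided) antipode: `m (S ⊗ I) Δ = m (I ⊗ S) Δ = η ε`. -/
def IsAntipode {Γ : Type*} [Finite Γ] (S : H Γ →ₗ[ℂ] H Γ) : Prop :=
  (LinearMap.mul' ℂ (H Γ) ∘ₗ TensorProduct.map S LinearMap.id ∘ₗ (comul Γ).toLinearMap =
      Algebra.linearMap ℂ (H Γ) ∘ₗ (counit Γ).toLinearMap) ∧
  (LinearMap.mul' ℂ (H Γ) ∘ₗ TensorProduct.map LinearMap.id S ∘ₗ (comul Γ).toLinearMap =
      Algebra.linearMap ℂ (H Γ) ∘ₗ (counit Γ).toLinearMap)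

/-! ### Layered trees -/

/-- A layered planar forest is given by its layers, **from the bottom to the top**. The non-leaf
vertices are the roots of the branches in these layers: position `p` of layer `m`. -/
abbrev Layers (Γ : Type*) := List (Layer Γ)

/-- `F` is a colored layered forest whose leaves are colored by `u` and whose roots are colored
by `w`: every vertex above the bottom level has an offspring, an only offspring has the color of
its parent, and the roots of each layer are the leaves of the layer just above it. -/
def IsLayeredForest {Γ : Type*} : List Γ → List Γ → Layers Γ → Prop
  | u, w, [] => u = w
  | u, w, L :: F => (∀ b ∈ L, b.Valid) ∧ L.leaves = u ∧ IsLayeredForest L.roots w F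

/-- Every non-leaf level has a non-degenerate vertex. -/
def IsProper {Γ : Type*} (F : Layers Γ) : Prop :=
  ∀ L ∈ F, ∃ b ∈ L, b.Nondegenerate

/-- `LT v j` is the set of the proper layered colored trees with root color `j` and
leaf coloring `v`. -/
def LT {Γ : Type*} (v : List Γ) (j : Γ) : Set (Layers Γ) :=
  {T | IsLayeredForest v [j] T ∧ IsProper T}

/-- Every non-degenerate vertex is the only non-degenerate vertex on its level. -/
def IsSimple {Γ : Type*} (F : Layers Γ) : Prop :=
  ∀ L ∈ F, ∀ (p q : ℕ) (x y : Branch Γ), L[p]? = some x → L[q]? = some y →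
    x.Nondegenerate → y.Nondegenerate → p = q

/-- The forest is order contractible at the vertex `x` in position `p` of layer `m`: `x` is
non-degenerate, its parent `x'` (in position `q` of the layer `M` above) is unary, there is no
non-degenerate vertex to the right of `x` on the level of `x`, and there is no non-degenerate
vertex to the left of `x'` on the level of `x'`. The two inequalities say that `x` is an
offspring of `x'`. -/
def OrderContractibleAt {Γ : Type*} (F : Layers Γ) (m p : ℕ) : Prop :=
  ∃ (L M : Layer Γ) (x x' : Branch Γ) (q : ℕ),
    F[m]? = some L ∧ F[m + 1]? = some M ∧ L[p]? = some x ∧ M[q]? = some x' ∧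
    (Layer.leaves (M.take q)).length ≤ p ∧ p < (Layer.leaves (M.take (q + 1))).length ∧
    x.Nondegenerate ∧ x'.Unary ∧
    (∀ (r : ℕ) (y : Branch Γ), p < r → L[r]? = some y → ¬ y.Nondegenerate) ∧
    (∀ (r : ℕ) (y : Branch Γ), r < q → M[r]? = some y → ¬ y.Nondegenerate)

/-- There is no vertex at which the forest is order contractible. -/
def IsOrderReduced {Γ : Type*} (F : Layers Γ) : Prop :=
  ∀ m p, ¬ OrderContractibleAt F m p

/-- `OST v j` is the set of the order-reduced simple (proper) layered colored trees with root
color `j` and leaf coloring `v`. -/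
def OST {Γ : Type*} (v : List Γ) (j : Γ) : Set (Layers Γ) :=
  {E | E ∈ LT v j ∧ IsSimple E ∧ IsOrderReduced E}

/-- The number of layers. -/
def numLayers {Γ : Type*} (F : Layers Γ) : ℕ := F.length

open Classical in
/-- `Ω(F) = Y(x_1) ⋯ Y(x_k)`, where `x_1 ≪ ⋯ ≪ x_k` are the non-degenerate vertices in the
ascending breadth first order: from the bottom level to the top one, and from left to right
within a level. -/
def Omega {Γ : Type*} (F : Layers Γ) : H Γ :=
  ((F.flatten.filter fun b => b.Nondegenerate).map fun b => Y b.leaves b.root).prod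

end IntervalHopf

end

/-! The antipode is the inverse of the identity in the convolution algebra of the coalgebra `H Γ`.
That algebra is associative (`coassoc`) and unital (`counit_comul`, `comul_counit`), so any left
inverse equals any right inverse. It suffices to have some left inverse and to verify that the tree
formula gives a right inverse.

The left inverse comes from recursion on word length (`exists_conv_id_eq_one`). Both inverses are
built as anti-homomorphisms, so the inverse property need only be checked on generators.

For the tree formula this check is `sum_blockProd_mul_signedSum`: the signed sum over pairs
(partition of `v`, order-reduced simple tree on its blocks) vanishes. The pairs cancel two by two.
One non-degenerate vertex is moved between the partition and a new lowest layer of the tree; this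
keeps the product of the `Y`'s and changes the number of layers by one. Order-reducedness decides
which vertex moves and in which direction, so that every pair is matched exactly once
(`partitionTrees_eq`, `disjoint_moveDown_moveUp`). -/

noncomputable section

namespace IntervalHopf

variable {Γ : Type*}

/-! ### Layers -/

namespace Layer

@[simp] theorem roots_nil : roots ([] : Layer Γ) = [] := rfl

@[simp] theorem roots_cons (b : Branch Γ) (L : Layer Γ) : roots (b :: L) = b.root :: roots L := rfl

@[simp] theorem roots_append (L M : Layer Γ) : roots (L ++ M) = roots L ++ roots M := by
  simp [roots]

@[simp] theorem length_roots (L : Layer Γ) : (roots L).length = L.length := by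
  simp [roots]

@[simp] theorem leaves_nil : leaves ([] : Layer Γ) = [] := rfl

@[simp] theorem leaves_cons (b : Branch Γ) (L : Layer Γ) :
    leaves (b :: L) = b.leaves ++ leaves L := rfl

@[simp] theorem leaves_append (L M : Layer Γ) : leaves (L ++ M) = leaves L ++ leaves M := by
  simp [leaves]

/-- The layer with unary vertices only, colored by `w`. -/
def units (w : List Γ) : Layer Γ := w.map fun c => ⟨c, [c]⟩

@[simp] theorem units_nil : units ([] : List Γ) = [] := rfl

@[simp] theorem units_cons (c : Γ) (w : List Γ) : units (c :: w) = ⟨c, [c]⟩ :: units w := rfl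

@[simp] theorem units_append (v w : List Γ) : units (v ++ w) = units v ++ units w := by
  simp [units]

@[simp] theorem length_units (w : List Γ) : (units w).length = w.length := by
  simp [units]

@[simp] theorem roots_units (w : List Γ) : roots (units w) = w := by
  induction w <;> simp_all

@[simp] theorem leaves_units (w : List Γ) : leaves (units w) = w := by
  induction w <;> simp_all

theorem units_injective : Function.Injective (units : List Γ → Layer Γ) := fun v w h => by
  simpa using congrArg roots h

theorem not_nondegenerate_of_mem_units {w : List Γ} {b : Branch Γ} (h : b ∈ units w) :
    ¬ b.Nondegenerate := by
  simp only [units, List.mem_map] at h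
  obtain ⟨c, -, rfl⟩ := h
  simp [Branch.Nondegenerate]

theorem valid_of_mem_units {w : List Γ} {b : Branch Γ} (h : b ∈ units w) : b.Valid := by
  simp only [units, List.mem_map] at h
  obtain ⟨c, -, rfl⟩ := h
  simp [Branch.Valid]

end Layer

open Layer

theorem Branch.Valid.eq_of_not_nondegenerate {b : Branch Γ} (h : b.Valid)
    (h' : ¬ b.Nondegenerate) : b = ⟨b.root, [b.root]⟩ := by
  obtain ⟨i, u⟩ := b
  have h1 := List.length_pos_iff.2 h.1
  simp only [Branch.Nondegenerate] at h' h1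
  obtain ⟨c, rfl⟩ := List.length_eq_one_iff.1 (show u.length = 1 by omega)
  have := h.2 c rfl
  simp_all

theorem Branch.Valid.length_pos {b : Branch Γ} (h : b.Valid) : 1 ≤ b.leaves.length :=
  List.length_pos_iff.2 h.1

theorem Branch.Nondegenerate.valid {b : Branch Γ} (h : b.Nondegenerate) : b.Valid := by
  refine ⟨fun e => ?_, fun c e => ?_⟩ <;> simp [Branch.Nondegenerate, e] at h

namespace Layer

theorem eq_units_roots {L : Layer Γ} (h : ∀ b ∈ L, b.Valid) (h' : ∀ b ∈ L, ¬ b.Nondegenerate) :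
    L = units L.roots := by
  induction L with
  | nil => rfl
  | cons b L ih =>
    rw [roots_cons, units_cons, ← ih (fun b hb => h b (by simp [hb]))
      (fun b hb => h' b (by simp [hb])),
      ← (h b (by simp)).eq_of_not_nondegenerate (h' b (by simp))]

theorem eq_units_leaves {L : Layer Γ} (h : ∀ b ∈ L, b.Valid) (h' : ∀ b ∈ L, ¬ b.Nondegenerate) :
    L = units L.leaves := by
  rw [eq_units_roots h h', leaves_units]

theorem length_le_length_leaves {L : Layer Γ} (h : ∀ b ∈ L, b.Valid) :
    L.length ≤ L.leaves.length := by
  induction L with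
  | nil => simp
  | cons b L ih =>
    have := ih fun b hb => h b (by simp [hb])
    have := (h b (by simp)).length_pos
    simp
    omega

theorem length_lt_length_leaves {L : Layer Γ} (h : ∀ b ∈ L, b.Valid) {b : Branch Γ} (hb : b ∈ L)
    (hb' : b.Nondegenerate) : L.length < L.leaves.length := by
  obtain ⟨P, Q, rfl⟩ := List.append_of_mem hb
  have h1 := length_le_length_leaves (L := P) fun b hb => h b (by simp [hb])
  have h2 := length_le_length_leaves (L := Q) fun b hb => h b (by simp [hb])
  simp only [Branch.Nondegenerate] at hb'
  simp
  omega

theorem eq_nil_of_leaves {L : Layer Γ} (h : ∀ b ∈ L, b.Valid) (hL : L.leaves = []) : L = [] := by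
  have := length_le_length_leaves h
  rw [hL] at this
  simpa using this

theorem eq_singleton_of_leaves {L : Layer Γ} (h : ∀ b ∈ L, b.Valid) {c : Γ}
    (hL : L.leaves = [c]) : L = [⟨c, [c]⟩] := by
  have h1 : ∀ b ∈ L, ¬ b.Nondegenerate := fun b hb hb' => by
    have := length_lt_length_leaves h hb hb'
    simp only [hL, List.length_singleton, Nat.lt_one_iff, List.length_eq_zero_iff] at this
    simp [this] at hb
  rw [eq_units_leaves h h1, hL]
  rfl

end Layer

theorem Branch.Valid.comp {L : Layer Γ} (h : ∀ b ∈ L, b.Valid) {i : Γ}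
    (h' : (⟨i, L.roots⟩ : Branch Γ).Valid) : (⟨i, L.leaves⟩ : Branch Γ).Valid := by
  refine ⟨fun e => ?_, fun c e => ?_⟩
  · have := eq_nil_of_leaves h e
    subst this
    exact h'.1 rfl
  · have := eq_singleton_of_leaves h e
    subst this
    exact h'.2 c rfl

/-! ### Generators and coproduct -/

theorem Y_of_le {u : List Γ} (h : 2 ≤ u.length) (i : Γ) :
    Y u i = FreeAlgebra.ι ℂ (⟨(u, i), h⟩ : Generator Γ) := by
  simp [Y, h]

theorem Y_self (i : Γ) : Y [i] i = 1 := by simp [Y]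

/-- Terms whose top vertex would be a unary vertex of the wrong color drop out of coproduct sums by
this. -/
theorem Y_of_not_valid {u : List Γ} {i : Γ} (h : ¬ (⟨i, u⟩ : Branch Γ).Valid) : Y u i = 0 := by
  have h1 : ¬ 2 ≤ u.length := fun h' => h (Branch.Nondegenerate.valid h')
  have h2 : u ≠ [i] := by
    rintro rfl
    exact h (by simp [Branch.Valid])
  simp [Y, h1, h2]

open Classical in
theorem counit_Y (u : List Γ) (i : Γ) : counit Γ (Y u i) = if u = [i] then 1 else 0 := by
  by_cases h : 2 ≤ u.length
  · have : u ≠ [i] := by rintro rfl; simp at h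
    simp [Y_of_le h, counit, this]
  · by_cases h' : u = [i] <;> simp [Y, h, h']

@[simp] theorem blockProd_nil : blockProd ([] : Layer Γ) = 1 := rfl

@[simp] theorem blockProd_cons (b : Branch Γ) (L : Layer Γ) :
    blockProd (b :: L) = Y b.leaves b.root * blockProd L := by simp [blockProd]

@[simp] theorem blockProd_append (L M : Layer Γ) :
    blockProd (L ++ M) = blockProd L * blockProd M := by simp [blockProd]

@[simp] theorem blockProd_units (w : List Γ) : blockProd (units w) = 1 := by
  induction w with
  | nil => rfl
  | cons c w ih => simp [ih, Y_self]

theorem counit_blockProd_of_mem {L : Layer Γ} {b : Branch Γ} (hb : b ∈ L)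
    (hb' : b.Nondegenerate) : counit Γ (blockProd L) = 0 := by
  obtain ⟨P, Q, rfl⟩ := List.append_of_mem hb
  have : b.leaves ≠ [b.root] := fun e => by simp [Branch.Nondegenerate, e] at hb'
  simp [counit_Y, this]

section Finite

variable [Finite Γ]

/-- The finite set of colored ordered partitions. -/
def partitions (u : List Γ) : Finset (Layer Γ) := (coloredPartitions_finite u).toFinset

@[simp] theorem mem_partitions {u : List Γ} {L : Layer Γ} :
    L ∈ partitions u ↔ (∀ b ∈ L, b.Valid) ∧ L.leaves = u := by
  simp [partitions, coloredPartitions]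

theorem partitions_nil : partitions ([] : List Γ) = {[]} := by
  ext L
  simp only [mem_partitions, Finset.mem_singleton]
  refine ⟨fun h => eq_nil_of_leaves h.1 h.2, ?_⟩
  rintro rfl
  simp

theorem partitions_singleton (c : Γ) : partitions [c] = {[⟨c, [c]⟩]} := by
  ext L
  simp only [mem_partitions, Finset.mem_singleton]
  refine ⟨fun h => eq_singleton_of_leaves h.1 h.2, ?_⟩
  rintro rfl
  simp [Branch.Valid]

theorem comul_Y (u : List Γ) (i : Γ) :
    comul Γ (Y u i) = ∑ π ∈ partitions u, blockProd π ⊗ₜ[ℂ] Y π.roots i := by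
  by_cases h : 2 ≤ u.length
  · simp [Y_of_le h, comul, partitions]
  · match u, h with
    | [], _ => simp [partitions_nil, Y]
    | [c], _ =>
      rw [partitions_singleton, Finset.sum_singleton]
      by_cases hc : c = i
      · subst hc
        simp [Y_self, Algebra.TensorProduct.one_def]
      · simp [Y, hc]
    | _ :: _ :: _, h => simp at h

end Finite

/-! ### Anti-homomorphisms -/

/-- The algebra anti-homomorphism with given values on the generators. -/
def antiLift (s : Generator Γ → H Γ) : H Γ →ₗ[ℂ] H Γ :=
  (MulOpposite.opLinearEquiv ℂ).symm.toLinearMap ∘ₗ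
    (FreeAlgebra.lift ℂ fun g => MulOpposite.op (s g)).toLinearMap

theorem antiLift_ι (s : Generator Γ → H Γ) (g : Generator Γ) :
    antiLift s (FreeAlgebra.ι ℂ g) = s g := by
  simp [antiLift]

theorem antiLift_one (s : Generator Γ → H Γ) : antiLift s 1 = 1 := by
  simp [antiLift]

theorem antiLift_mul (s : Generator Γ → H Γ) (x y : H Γ) :
    antiLift s (x * y) = antiLift s y * antiLift s x := by
  simp [antiLift]

/-- Justifies the recursion in `exists_conv_id_eq_one`: only values on shorter words enter. -/
theorem antiLift_blockProd_congr {s t : Generator Γ → H Γ} {n : ℕ}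
    (h : ∀ g : Generator Γ, g.1.1.length < n → s g = t g) {π : Layer Γ}
    (hπ : ∀ b ∈ π, b.leaves.length < n) : antiLift s (blockProd π) = antiLift t (blockProd π) := by
  induction π with
  | nil => simp [antiLift_one]
  | cons b π ih =>
    rw [blockProd_cons, antiLift_mul, antiLift_mul, ih fun b hb => hπ b (by simp [hb])]
    congr 1
    by_cases hb : 2 ≤ b.leaves.length
    · rw [Y_of_le hb, antiLift_ι, antiLift_ι]
      exact h _ (hπ b (by simp))
    · unfold Y
      rw [dif_neg hb]
      split_ifs <;> simp [antiLift_one]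

/-! ### Coassociativity -/

/-- The layer obtained from two consecutive layers, the lower one first, by forgetting the level
between them. -/
def compose : Layer Γ → Layer Γ → Layer Γ
  | _, [] => []
  | L, b :: M =>
    ⟨b.root, leaves (L.take b.leaves.length)⟩ :: compose (L.drop b.leaves.length) M

theorem roots_compose (L M : Layer Γ) : (compose L M).roots = M.roots := by
  induction M generalizing L with
  | nil => rfl
  | cons b M ih => simp [compose, ih]

theorem roots_take_of_roots_eq_append {L : Layer Γ} {u v : List Γ} (h : L.roots = u ++ v) :
    roots (L.take u.length) = u ∧ roots (L.drop u.length) = v := by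
  simp only [roots, List.map_take, List.map_drop] at h ⊢
  simp [h]

theorem leaves_compose {L M : Layer Γ} (h : L.roots = M.leaves) :
    (compose L M).leaves = L.leaves := by
  induction M generalizing L with
  | nil =>
    have : L = [] := by simpa [roots] using h
    simp [this, compose]
  | cons b M ih =>
    have := roots_take_of_roots_eq_append (h.trans (leaves_cons b M))
    simp only [compose, leaves_cons, ih this.2]
    rw [← leaves_append, List.take_append_drop]

theorem valid_compose {L M : Layer Γ} (h : L.roots = M.leaves) (hL : ∀ b ∈ L, b.Valid)
    (hM : ∀ b ∈ M, b.Valid) : ∀ b ∈ compose L M, b.Valid := by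
  induction M generalizing L with
  | nil => simp [compose]
  | cons b M ih =>
    have := roots_take_of_roots_eq_append (h.trans (leaves_cons b M))
    simp only [compose, List.mem_cons, forall_eq_or_imp]
    refine ⟨Branch.Valid.comp (fun b hb => hL b (List.mem_of_mem_take hb)) ?_,
      ih this.2 (fun b hb => hL b (List.mem_of_mem_drop hb)) fun b hb => hM b (by simp [hb])⟩
    rw [this.1]
    exact hM b (by simp)

theorem compose_append (K L M : Layer Γ) (i : Γ) :
    compose (K ++ L) (⟨i, K.roots⟩ :: M) = ⟨i, K.leaves⟩ :: compose L M := by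
  simp [compose]

section Finite

variable [Finite Γ]

/-- The pairs of consecutive layers, the lower one first, with given leaves. -/
def refinements (u : List Γ) : Finset (Σ _ : Layer Γ, Layer Γ) :=
  (partitions u).sigma fun L => partitions L.roots

theorem mem_refinements {u : List Γ} {z : Σ _ : Layer Γ, Layer Γ} :
    z ∈ refinements u ↔ ((∀ b ∈ z.1, b.Valid) ∧ z.1.leaves = u) ∧
      (∀ b ∈ z.2, b.Valid) ∧ z.2.leaves = z.1.roots := by
  simp [refinements]

open Classical in
-- Each block of `π` is split independently; placing the splittings side by side gives all two-layer
-- forests whose middle level can be forgotten to leave `π`.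
theorem comul_blockProd (π : Layer Γ) :
    comul Γ (blockProd π) = ∑ z ∈ (refinements π.leaves).filter (fun z => compose z.1 z.2 = π),
      blockProd z.1 ⊗ₜ[ℂ] blockProd z.2 := by
  induction π with
  | nil =>
    have : (refinements (leaves ([] : Layer Γ))).filter (fun z => compose z.1 z.2 = []) =
        {⟨[], []⟩} := by
      ext ⟨L, M⟩
      simp only [Finset.mem_filter, mem_refinements, Finset.mem_singleton]
      constructor
      · rintro ⟨⟨h1, h2⟩, -⟩
        obtain rfl := eq_nil_of_leaves h1.1 h1.2
        obtain rfl := eq_nil_of_leaves h2.1 h2.2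
        rfl
      · intro h
        cases h
        simp [compose]
    rw [this]
    simp [Algebra.TensorProduct.one_def]
  | cons b π ih =>
    -- The sum from `comul_Y` also contains one-block partitions of a color other than `b.root`.
    -- These terms vanish and form no legal upper branch, so they are filtered out before the
    -- bijection.
    rw [blockProd_cons, map_mul, comul_Y, ih, Finset.sum_mul_sum, ← Finset.sum_product',
      ← Finset.sum_filter_of_ne (p := fun x => (⟨b.root, roots x.1⟩ : Branch Γ).Valid)]
    -- The first upper branch tells how many lower blocks lie under `b`. The default `0` is never
    -- used, since the upper layer is nonempty.
    · refine Finset.sum_nbij'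
        (fun x => ⟨x.1 ++ x.2.1, ⟨b.root, roots x.1⟩ :: x.2.2⟩)
        (fun z => (z.1.take ((z.2.head?.map fun c => c.leaves.length).getD 0),
          ⟨z.1.drop ((z.2.head?.map fun c => c.leaves.length).getD 0), z.2.tail⟩)) ?_ ?_ ?_ ?_ ?_
      · rintro ⟨K, L, M⟩ h
        simp only [Finset.mem_filter, Finset.mem_product, mem_partitions, mem_refinements] at h
        obtain ⟨⟨⟨h1, h2⟩, ⟨⟨h3, h4⟩, h5, h6⟩, h7⟩, h8⟩ := h
        simp only [Finset.mem_filter, mem_refinements, compose_append, h7, h2]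
        refine ⟨⟨⟨?_, by simp [h2, h4]⟩, ?_, by simp [h6]⟩, trivial⟩
        · intro c hc
          rcases List.mem_append.1 hc with hc | hc
          exacts [h1 c hc, h3 c hc]
        · intro c hc
          rcases List.mem_cons.1 hc with rfl | hc
          exacts [h8, h5 c hc]
      · rintro ⟨L, M⟩ h
        simp only [Finset.mem_filter, mem_refinements] at h
        obtain ⟨⟨⟨h1, h2⟩, h3, h4⟩, h5⟩ := h
        cases M with
        | nil => simp [compose] at h5
        | cons c M =>
          have h6 := roots_take_of_roots_eq_append (h4.symm.trans (leaves_cons c M))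
          simp only [compose, List.cons.injEq] at h5
          obtain ⟨rfl, h7⟩ := h5
          simp only [Finset.mem_filter, Finset.mem_product, mem_partitions, mem_refinements,
            List.head?_cons, Option.map_some, Option.getD_some, List.tail_cons, h6.1, h6.2, h7,
            and_true]
          refine ⟨⟨fun c hc => h1 c (List.mem_of_mem_take hc),
            ⟨fun c hc => h1 c (List.mem_of_mem_drop hc), ?_⟩,
            fun c hc => h3 c (by simp [hc])⟩, h3 c (by simp)⟩
          rw [← h7, leaves_compose h6.2]
      · rintro ⟨K, L, M⟩ h
        simp
      · rintro ⟨L, M⟩ h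
        simp only [Finset.mem_filter, mem_refinements] at h
        obtain ⟨⟨⟨h1, h2⟩, h3, h4⟩, h5⟩ := h
        cases M with
        | nil => simp [compose] at h5
        | cons c M =>
          have h6 := roots_take_of_roots_eq_append (h4.symm.trans (leaves_cons c M))
          simp only [compose, List.cons.injEq] at h5
          obtain ⟨rfl, h7⟩ := h5
          simp [h6.1]
      · rintro ⟨K, L, M⟩ h
        simp
    · rintro ⟨K, L, M⟩ h h'
      by_contra h''
      apply h'
      simp [Y_of_not_valid h'']

/-- Both sides sum the same tensors over all pairs of consecutive layers above `u`; the left side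
groups the pairs by their composite, which has the roots of the upper layer. -/
theorem coassoc :
    (Algebra.TensorProduct.assoc ℂ ℂ ℂ (H Γ) (H Γ) (H Γ)).toAlgHom.comp
      ((Algebra.TensorProduct.map (comul Γ) (.id ℂ (H Γ))).comp (comul Γ)) =
    (Algebra.TensorProduct.map (.id ℂ (H Γ)) (comul Γ)).comp (comul Γ) := by
  classical
  refine FreeAlgebra.hom_ext (funext fun g => ?_)
  obtain ⟨⟨u, i⟩, hg⟩ := g
  have e := comul_Y u i
  rw [Y_of_le hg] at e
  simp only [Function.comp_apply, AlgHom.comp_apply, e, map_sum,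
    Algebra.TensorProduct.map_tmul, AlgHom.id_apply, comul_Y, comul_blockProd,
    TensorProduct.sum_tmul, TensorProduct.tmul_sum]
  rw [Finset.sum_sigma' (partitions u) (fun L => partitions L.roots)
    (fun L M => blockProd L ⊗ₜ[ℂ] (blockProd M ⊗ₜ[ℂ] Y M.roots i))]
  change _ = ∑ z ∈ refinements u, _
  rw [← Finset.sum_fiberwise_of_maps_to (s := refinements u) (t := partitions u) (g := fun z => compose z.1 z.2)]
  · refine Finset.sum_congr rfl fun π hπ => ?_
    rw [(mem_partitions.1 hπ).2]
    refine Finset.sum_congr rfl fun z hz => ?_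
    rw [← (Finset.mem_filter.1 hz).2, roots_compose]
    rfl
  · intro z hz
    rw [mem_refinements] at hz
    rw [mem_partitions, leaves_compose hz.2.2.symm]
    exact ⟨valid_compose hz.2.2.symm hz.1.1 hz.2.1, hz.1.2⟩

theorem counit_comul :
    (Algebra.TensorProduct.map (counit Γ) (.id ℂ (H Γ))).comp (comul Γ) =
      (Algebra.TensorProduct.lid ℂ (H Γ)).symm := by
  refine FreeAlgebra.hom_ext (funext fun g => ?_)
  obtain ⟨⟨u, i⟩, hg⟩ := g
  have e := comul_Y u i
  rw [Y_of_le hg] at e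
  simp only [Function.comp_apply, AlgHom.comp_apply, e, map_sum,
    Algebra.TensorProduct.map_tmul, AlgHom.id_apply]
  -- Every partition other than the finest has a non-degenerate block, which the counit kills.
  rw [Finset.sum_eq_single (units u)]
  · simp [Y_of_le hg]
  · intro π hπ h
    rw [mem_partitions] at hπ
    obtain ⟨b, hb, hb'⟩ : ∃ b ∈ π, b.Nondegenerate := by
      by_contra! h'
      exact h (hπ.2 ▸ eq_units_leaves hπ.1 h')
    simp [counit_blockProd_of_mem hb hb']
  · intro h
    exact absurd (mem_partitions.2 ⟨fun b hb => valid_of_mem_units hb, leaves_units u⟩) h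

theorem comul_counit :
    (Algebra.TensorProduct.map (.id ℂ (H Γ)) (counit Γ)).comp (comul Γ) =
      (Algebra.TensorProduct.rid ℂ ℂ (H Γ)).symm := by
  refine FreeAlgebra.hom_ext (funext fun g => ?_)
  obtain ⟨⟨u, i⟩, hg⟩ := g
  have e := comul_Y u i
  rw [Y_of_le hg] at e
  simp only [Function.comp_apply, AlgHom.comp_apply, e, map_sum,
    Algebra.TensorProduct.map_tmul, AlgHom.id_apply]
  -- The counit of `Y π.roots i` is nonzero only if `π` is a single block of color `i`.
  rw [Finset.sum_eq_single [⟨i, u⟩]]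
  · simp [Y_of_le hg, counit_Y]
  · intro π hπ h
    rw [mem_partitions] at hπ
    have : roots π ≠ [i] := by
      intro h'
      obtain ⟨b, rfl⟩ := List.length_eq_one_iff.1 (by simpa using congrArg List.length h')
      simp only [roots_cons, roots_nil, List.cons.injEq, and_true, leaves_cons, leaves_nil,
        List.append_nil] at h' hπ
      exact h (by rw [← h', ← hπ.2])
    simp [counit_Y, this]
  · intro h
    refine absurd (mem_partitions.2 ⟨fun b hb => ?_, by simp⟩) h
    rw [List.mem_singleton.1 hb]
    exact Branch.Nondegenerate.valid hg

/-! ### The coalgebra and its convolution product -/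

instance : Coalgebra ℂ (H Γ) where
  comul := (comul Γ).toLinearMap
  counit := (counit Γ).toLinearMap
  coassoc := congrArg AlgHom.toLinearMap coassoc
  rTensor_counit_comp_comul := congrArg AlgHom.toLinearMap counit_comul
  lTensor_counit_comp_comul := congrArg AlgHom.toLinearMap comul_counit

theorem isAntipode_iff (S : H Γ →ₗ[ℂ] H Γ) : IsAntipode S ↔
    WithConv.toConv S * WithConv.toConv (LinearMap.id : H Γ →ₗ[ℂ] H Γ) = 1 ∧
      WithConv.toConv (LinearMap.id : H Γ →ₗ[ℂ] H Γ) * WithConv.toConv S = 1 := by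
  rw [← (WithConv.ofConv_injective).eq_iff, ← (WithConv.ofConv_injective).eq_iff]
  exact Iff.rfl

/-! ### Convolution inverses of the identity -/

/-- An algebra anti-homomorphism is a right convolution inverse of the identity if it is one on
the generators. -/
theorem id_conv_antiLift {s : Generator Γ → H Γ}
    (h : ∀ g : Generator Γ, ∑ π ∈ partitions g.1.1, blockProd π * antiLift s (Y π.roots g.1.2) = 0) :
    WithConv.toConv (LinearMap.id : H Γ →ₗ[ℂ] H Γ) * WithConv.toConv (antiLift s) = 1 := by
  set m : H Γ ⊗[ℂ] H Γ →ₗ[ℂ] H Γ :=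
    LinearMap.mul' ℂ (H Γ) ∘ₗ TensorProduct.map LinearMap.id (antiLift s) with hm
  -- Antimultiplicativity puts `m t'` in the middle of the product; being a scalar there, it can be
  -- pulled out.
  have hmul : ∀ (t t' : H Γ ⊗[ℂ] H Γ) (c : ℂ), m t' = algebraMap ℂ (H Γ) c →
      m (t * t') = c • m t := by
    intro t t' c hc
    induction t with
    | zero => simp
    | add t₁ t₂ h₁ h₂ => rw [add_mul, map_add, h₁, h₂, map_add, smul_add]
    | tmul a b =>
      have : m ((a ⊗ₜ b) * t') = a * m t' * antiLift s b := by
        clear hc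
        induction t' with
        | zero => simp
        | add t₁ t₂ h₁ h₂ => simp [mul_add, h₁, h₂, add_mul]
        | tmul a' b' => simp [hm, antiLift_mul, mul_assoc]
      rw [this, hc, ← Algebra.commutes, mul_assoc, ← Algebra.smul_def]
      simp [hm]
  have key : ∀ x : H Γ, m (comul Γ x) = algebraMap ℂ (H Γ) (counit Γ x) := by
    intro x
    induction x using FreeAlgebra.induction with
    | grade0 r => simp [hm, antiLift_one, Algebra.algebraMap_eq_smul_one, Algebra.TensorProduct.one_def]
    | grade1 g =>
      have e := comul_Y g.1.1 g.1.2
      rw [Y_of_le g.2] at e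
      rw [e, map_sum]
      simpa [hm, counit] using h g
    | mul x y hx hy =>
      rw [map_mul, hmul _ _ _ hy, hx, map_mul, map_mul, ← Algebra.commutes, Algebra.smul_def]
    | add x y hx hy => simp only [map_add, hx, hy]
  refine WithConv.ofConv_injective (LinearMap.ext key)

/-- An algebra anti-homomorphism is a left convolution inverse of the identity if it is one on
the generators. -/
theorem antiLift_conv_id {s : Generator Γ → H Γ}
    (h : ∀ g : Generator Γ, ∑ π ∈ partitions g.1.1, antiLift s (blockProd π) * Y π.roots g.1.2 = 0) :
    WithConv.toConv (antiLift s) * WithConv.toConv (LinearMap.id : H Γ →ₗ[ℂ] H Γ) = 1 := by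
  set m : H Γ ⊗[ℂ] H Γ →ₗ[ℂ] H Γ :=
    LinearMap.mul' ℂ (H Γ) ∘ₗ TensorProduct.map (antiLift s) LinearMap.id with hm
  have hmul : ∀ (t t' : H Γ ⊗[ℂ] H Γ) (c : ℂ), m t = algebraMap ℂ (H Γ) c →
      m (t * t') = c • m t' := by
    intro t t' c hc
    induction t' with
    | zero => simp
    | add t₁ t₂ h₁ h₂ => rw [mul_add, map_add, h₁, h₂, map_add, smul_add]
    | tmul a b =>
      have : m (t * (a ⊗ₜ b)) = antiLift s a * m t * b := by
        clear hc
        induction t with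
        | zero => simp
        | add t₁ t₂ h₁ h₂ => simp [mul_add, h₁, h₂, add_mul]
        | tmul a' b' => simp [hm, antiLift_mul, mul_assoc]
      rw [this, hc, ← Algebra.commutes, mul_assoc, ← Algebra.smul_def]
      simp [hm]
  have key : ∀ x : H Γ, m (comul Γ x) = algebraMap ℂ (H Γ) (counit Γ x) := by
    intro x
    induction x using FreeAlgebra.induction with
    | grade0 r => simp [hm, antiLift_one, Algebra.algebraMap_eq_smul_one, Algebra.TensorProduct.one_def]
    | grade1 g =>
      have e := comul_Y g.1.1 g.1.2
      rw [Y_of_le g.2] at e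
      rw [e, map_sum]
      simpa [hm, counit] using h g
    | mul x y hx hy =>
      rw [map_mul, hmul _ _ _ hx, hy, map_mul, map_mul, Algebra.smul_def]
    | add x y hx hy => simp only [map_add, hx, hy]
  refine WithConv.ofConv_injective (LinearMap.ext key)

open Classical in
/-- The identity has a left convolution inverse. -/
theorem exists_conv_id_eq_one :
    ∃ S : WithConv (H Γ →ₗ[ℂ] H Γ), S * WithConv.toConv LinearMap.id = 1 := by
  -- The defining equation is solved for the one-block term, which equals `s g`. The value `0` on
  -- words that are not shorter is a filler.
  let F : (g : Generator Γ) → ((g' : Generator Γ) → g'.1.1.length < g.1.1.length → H Γ) → H Γ :=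
    fun g rec => - ∑ π ∈ (partitions g.1.1).erase [⟨g.1.2, g.1.1⟩],
      antiLift (fun g' => if h : g'.1.1.length < g.1.1.length then rec g' h else 0) (blockProd π) *
        Y π.roots g.1.2
  have wf : WellFounded fun g g' : Generator Γ => g.1.1.length < g'.1.1.length :=
    (measure fun g : Generator Γ => g.1.1.length).wf
  let s := wf.fix F
  refine ⟨WithConv.toConv (antiLift s), antiLift_conv_id fun g => ?_⟩
  have hmem : [⟨g.1.2, g.1.1⟩] ∈ partitions g.1.1 := by
    refine mem_partitions.2 ⟨fun b hb => ?_, by simp⟩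
    rw [List.mem_singleton.1 hb]
    exact Branch.Nondegenerate.valid g.2
  have e : antiLift s (blockProd [⟨g.1.2, g.1.1⟩]) * Y (roots [⟨g.1.2, g.1.1⟩]) g.1.2 = s g := by
    simp [Y_self, Y_of_le g.2, antiLift_ι]
  rw [← Finset.add_sum_erase _ _ hmem, e, show s g = _ from wf.fix_eq F g, neg_add_eq_zero]
  refine Finset.sum_congr rfl fun π hπ => ?_
  rw [Finset.mem_erase, mem_partitions] at hπ
  obtain ⟨h1, h2, h3⟩ := hπ
  by_cases h : ∀ b ∈ π, b.leaves.length < g.1.1.length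
  · rw [antiLift_blockProd_congr (t := s) _ h]
    intro g' hg'
    simp only [hg', dif_pos]
    rfl
  -- A block as long as the whole word is the only block; having the wrong color, it contributes `Y
  -- [b.root] g.1.2 = 0`.
  · push Not at h
    obtain ⟨b, hb, hb'⟩ := h
    obtain ⟨P, Q, rfl⟩ := List.append_of_mem hb
    have h4 := length_le_length_leaves (L := P) fun b hb => h2 b (by simp [hb])
    have h5 := length_le_length_leaves (L := Q) fun b hb => h2 b (by simp [hb])
    have h6 := congrArg List.length h3
    simp only [leaves_append, leaves_cons, List.length_append] at h6
    obtain rfl : P = [] := List.length_eq_zero_iff.1 (by omega)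
    obtain rfl : Q = [] := List.length_eq_zero_iff.1 (by omega)
    have h7 : b.leaves = g.1.1 := by simpa using h3
    have h8 : b.root ≠ g.1.2 := fun h8 => h1 (by rw [← h7, ← h8]; rfl)
    simp [Y, h8]

end Finite

/-! ### Layers with a last non-degenerate vertex -/

namespace Layer

theorem eq_append_units {L : Layer Γ} (hL : ∀ b ∈ L, b.Valid) :
    L = units L.roots ∨
      ∃ (P : Layer Γ) (x : Branch Γ) (c : List Γ), x.Nondegenerate ∧ L = P ++ x :: units c := by
  induction L with
  | nil => exact Or.inl rfl
  | cons b L ih =>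
    rcases ih fun b hb => hL b (by simp [hb]) with h | ⟨P, x, c, hx, h⟩
    · by_cases hb : b.Nondegenerate
      · exact Or.inr ⟨[], b, roots L, hb, by rw [← h]; rfl⟩
      · left
        rw [roots_cons, units_cons, ← h, ← (hL b (by simp)).eq_of_not_nondegenerate hb]
    · exact Or.inr ⟨b :: P, x, c, hx, by rw [h]; rfl⟩

/-- A non-degenerate vertex cannot lie in a unary tail. Both the uniqueness of the last such vertex
and the disjointness of the two kinds of pairs rest on this. -/
theorem length_lt_of_append_units_eq {P P' : Layer Γ} {x : Branch Γ} {c w : List Γ}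
    (hx : x.Nondegenerate) (h : P ++ x :: units c = P' ++ units w) : P.length < P'.length := by
  by_contra! hlt
  have e : (P ++ x :: units c)[P.length]? = some x := by simp
  rw [h, List.getElem?_append_right hlt] at e
  exact not_nondegenerate_of_mem_units (List.mem_of_getElem? e) hx

theorem append_units_inj {P P' : Layer Γ} {x x' : Branch Γ} {c c' : List Γ}
    (hx : x.Nondegenerate) (hx' : x'.Nondegenerate)
    (h : P ++ x :: units c = P' ++ x' :: units c') : P = P' ∧ x = x' ∧ c = c' := by
  have h1 := length_lt_of_append_units_eq (P' := P' ++ [x']) hx (by simpa using h)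
  have h2 := length_lt_of_append_units_eq (P' := P ++ [x]) hx' (by simpa using h.symm)
  simp only [List.length_append, List.length_singleton] at h1 h2
  obtain ⟨rfl, h3⟩ := List.append_inj h (by omega)
  simp only [List.cons.injEq] at h3
  exact ⟨rfl, h3.1, units_injective h3.2⟩

theorem eq_of_getElem?_append_units {r d : List Γ} {x y : Branch Γ} {k : ℕ}
    (hk : (units r ++ x :: units d)[k]? = some y) (hy : y.Nondegenerate) :
    k = r.length ∧ y = x := by
  rcases lt_trichotomy k r.length with h | rfl | h
  · rw [List.getElem?_append_left (by simpa using h)] at hk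
    exact absurd hy (not_nondegenerate_of_mem_units (List.mem_of_getElem? hk))
  · rw [List.getElem?_append_right (by simp)] at hk
    simp only [length_units, Nat.sub_self, List.getElem?_cons_zero, Option.some.injEq] at hk
    exact ⟨rfl, hk.symm⟩
  · rw [List.getElem?_append_right (by simpa using h.le), length_units,
      show k - r.length = (k - r.length - 1) + 1 by omega, List.getElem?_cons_succ] at hk
    exact absurd hy (not_nondegenerate_of_mem_units (List.mem_of_getElem? hk))

theorem units_take (r : List Γ) (n : ℕ) : (units r).take n = units (r.take n) := by
  simp [units, List.map_take]

theorem valid_append_units {P : Layer Γ} (hP : ∀ b ∈ P, b.Valid) {x : Branch Γ}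
    (hx : x.Nondegenerate) (c : List Γ) : ∀ b ∈ P ++ x :: units c, b.Valid := by
  intro b hb
  rcases List.mem_append.1 hb with hb | hb
  · exact hP b hb
  · rcases List.mem_cons.1 hb with rfl | hb
    exacts [hx.valid, valid_of_mem_units hb]

end Layer

/-! ### Order contractions between consecutive layers -/

/-- With one non-degenerate vertex per level, contractibility only asks that the parent of `x` lie
to the left of `y`. There the upper layer is unary, so parent and offspring have equal positions. -/
theorem exists_orderContractibleAt_zero_iff {p c r d : List Γ} {x y : Branch Γ}
    (hx : x.Nondegenerate) (hy : y.Nondegenerate) (E : Layers Γ) :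
    (∃ k, OrderContractibleAt ((units p ++ x :: units c) :: (units r ++ y :: units d) :: E) 0 k) ↔
      p.length < r.length := by
  constructor
  · rintro ⟨k, L, M, z, z', q, hL, hM, hz, hz', h1, h2, hnd, hun, -, hleft⟩
    simp only [List.getElem?_cons_zero, Option.some.injEq, zero_add, List.getElem?_cons_succ]
      at hL hM
    subst hL hM
    have hq : q < r.length := by
      -- At position `r.length` the parent would be `y`, which is not unary; further right it would
      -- have `y` on its left.
      by_contra! hq
      rcases hq.eq_or_lt with rfl | hq
      · simp only [List.getElem?_append_right, length_units, le_refl, Nat.sub_self,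
          List.getElem?_cons_zero, Option.some.injEq] at hz'
        subst hz'
        simp only [Branch.Unary, Branch.Nondegenerate] at hun hy
        omega
      · exact hleft r.length y hq (by simp) hy
    rw [List.take_append_of_le_length (by simp; omega), units_take, leaves_units] at h1 h2
    simp only [List.length_take] at h1 h2
    have := (eq_of_getElem?_append_units hz hnd).1
    omega
  · intro h
    refine ⟨p.length, _, _, x, ⟨r[p.length], [r[p.length]]⟩, p.length, rfl, rfl, ?_, ?_, ?_, ?_,
      hx, by simp [Branch.Unary], ?_, ?_⟩
    · simp
    · rw [List.getElem?_append_left (by simpa using h)]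
      simp [units, h]
    · rw [List.take_append_of_le_length (by simp; omega), units_take, leaves_units]
      simp
    · rw [List.take_append_of_le_length (by simp; omega), units_take, leaves_units]
      simp
      omega
    · intro k z hk hz hnd
      have := (eq_of_getElem?_append_units hz hnd).1
      omega
    · intro k z hk hz hnd
      have := (eq_of_getElem?_append_units hz hnd).1
      omega

theorem not_orderContractibleAt_singleton (L : Layer Γ) (k : ℕ) :
    ¬ OrderContractibleAt [L] 0 k := by
  rintro ⟨_, _, _, _, _, _, h, _⟩
  simp at h

theorem isOrderReduced_cons {L : Layer Γ} {E : Layers Γ} :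
    IsOrderReduced (L :: E) ↔ (¬ ∃ k, OrderContractibleAt (L :: E) 0 k) ∧ IsOrderReduced E := by
  have h : ∀ m p, OrderContractibleAt (L :: E) (m + 1) p ↔ OrderContractibleAt E m p := by
    intro m p
    simp only [OrderContractibleAt, List.getElem?_cons_succ]
  refine ⟨fun H => ⟨fun ⟨k, hk⟩ => H 0 k hk, fun m p hp => H (m + 1) p ((h m p).2 hp)⟩,
    fun H m p hp => ?_⟩
  cases m with
  | zero => exact H.1 ⟨p, hp⟩
  | succ m => exact H.2 m p ((h m p).1 hp)

/-! ### Removing the lowest layer of an order-reduced simple tree -/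

theorem nil_mem_OST {v : List Γ} {j : Γ} : [] ∈ OST v j ↔ v = [j] := by
  simp [OST, LT, IsLayeredForest, IsProper, IsSimple, IsOrderReduced, OrderContractibleAt]

theorem exists_of_cons_mem_OST {v : List Γ} {j : Γ} {L : Layer Γ} {E : Layers Γ}
    (h : L :: E ∈ OST v j) :
    ∃ (p : List Γ) (x : Branch Γ) (c : List Γ), x.Nondegenerate ∧ L = units p ++ x :: units c := by
  obtain ⟨⟨⟨hv, -, -⟩, hp⟩, hs, -⟩ := h
  obtain ⟨y, hy, hy'⟩ := hp L (by simp)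
  rcases eq_append_units hv with e | ⟨P, x, c, hx, rfl⟩
  · rw [e] at hy
    exact absurd hy' (not_nondegenerate_of_mem_units hy)
  · refine ⟨P.roots, x, c, hx, ?_⟩
    rw [← eq_units_roots (fun b hb => hv b (by simp [hb]))]
    intro b hb hb'
    obtain ⟨q, hq, e⟩ := List.getElem_of_mem hb
    have hq' : (P ++ x :: units c)[q]? = some b := by
      rw [List.getElem?_append_left hq, List.getElem?_eq_getElem hq, e]
    have := hs (P ++ x :: units c) (by simp) q P.length b x hq' (by simp) hb' hx
    omega

theorem append_units_cons_mem_OST {p c u : List Γ} {x : Branch Γ} {j : Γ} {E : Layers Γ}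
    (hx : x.Nondegenerate) :
    (units p ++ x :: units c) :: E ∈ OST u j ↔ p ++ x.leaves ++ c = u ∧
      E ∈ OST (p ++ x.root :: c) j ∧
        ¬ ∃ k, OrderContractibleAt ((units p ++ x :: units c) :: E) 0 k := by
  have h1 : ∀ b ∈ units p ++ x :: units c, b.Valid :=
    valid_append_units (fun b hb => valid_of_mem_units hb) hx c
  have h2 : ∃ b ∈ units p ++ x :: units c, b.Nondegenerate := ⟨x, by simp, hx⟩
  have h3 : ∀ (k l : ℕ) (y z : Branch Γ), (units p ++ x :: units c)[k]? = some y →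
      (units p ++ x :: units c)[l]? = some z → y.Nondegenerate → z.Nondegenerate → k = l :=
    fun k l y z hy hz hy' hz' => (eq_of_getElem?_append_units hy hy').1.trans
      (eq_of_getElem?_append_units hz hz').1.symm
  simp only [OST, LT, Set.mem_ofPred_eq, IsLayeredForest, isOrderReduced_cons, IsProper, IsSimple,
    List.forall_mem_cons]
  simp only [leaves_append, leaves_units, leaves_cons, roots_append, roots_units, roots_cons,
    List.append_assoc]
  tauto

theorem valid_of_cons_mem_OST {v : List Γ} {j : Γ} {L : Layer Γ} {E : Layers Γ}
    (h : L :: E ∈ OST v j) : (∀ b ∈ L, b.Valid) := h.1.1.1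

open Classical in
-- Valid degenerate vertices contribute `Y [c] c = 1`, so the filter in `Omega` does not matter.
theorem Omega_cons {L : Layer Γ} (hL : ∀ b ∈ L, b.Valid) (E : Layers Γ) :
    Omega (L :: E) = blockProd L * Omega E := by
  simp only [Omega, List.flatten_cons, List.filter_append, List.map_append, List.prod_append]
  congr 1
  induction L with
  | nil => rfl
  | cons b L ih =>
    have := ih fun b hb => hL b (by simp [hb])
    rw [blockProd_cons, ← this]
    by_cases hb : b.Nondegenerate
    · simp [hb]
    · have e := (hL b (by simp)).eq_of_not_nondegenerate hb
      have : Y b.leaves b.root = 1 := by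
        rw [e]
        exact Y_self _
      simp [hb, this]

/-- A proper layer has fewer roots than leaves, so the word shrinks at each level. -/
theorem LT_finite [Finite Γ] (v : List Γ) (j : Γ) : (LT v j).Finite := by
  induction hn : v.length using Nat.strong_induction_on generalizing v with
  | _ n ih =>
    subst hn
    refine ((Set.finite_singleton ([] : Layers Γ)).union
      (((coloredPartitions_finite v).subset (Set.sep_subset _ fun L => L.length < v.length)).biUnion
        fun L hL => (ih L.roots.length (by simpa using hL.2) L.roots rfl).image
          fun E => L :: E)).subset ?_
    rintro (_ | ⟨L, E⟩) ⟨h, h'⟩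
    · exact Or.inl rfl
    · obtain ⟨b, hb, hb'⟩ := h' L (by simp)
      refine Or.inr (Set.mem_biUnion (x := L) ⟨⟨h.1, h.2.1⟩, ?_⟩
        ⟨E, ⟨h.2.2, fun M hM => h' M (by simp [hM])⟩, rfl⟩)
      rw [← h.2.1]
      exact length_lt_length_leaves h.1 hb hb'

theorem OST_finite [Finite Γ] (v : List Γ) (j : Γ) : (OST v j).Finite :=
  (LT_finite v j).subset fun _ h => h.1

/-! ### Cancellation -/

/-- Pairs of a colored ordered partition of `v` and an order reduced simple tree on its blocks. -/
def partitionTrees (v : List Γ) (j : Γ) : Set (Layer Γ × Layers Γ) :=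
  {z | z.1 ∈ coloredPartitions v ∧ z.2 ∈ OST z.1.roots j}

/-- A partition `P ++ x :: units c` of `v` with last non-degenerate block `x`, together with a tree
above it, such that moving `x` to a layer of its own gives an order reduced tree. -/
def movables (v : List Γ) (j : Γ) : Set (Layer Γ × Branch Γ × List Γ × Layers Γ) :=
  {d | (∀ b ∈ d.1, b.Valid) ∧ d.2.1.Nondegenerate ∧ d.1.leaves ++ d.2.1.leaves ++ d.2.2.1 = v ∧
    (units d.1.roots ++ d.2.1 :: units d.2.2.1) :: d.2.2.2 ∈
      OST (d.1.roots ++ d.2.1.leaves ++ d.2.2.1) j}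

/-- The movable vertex belongs to the partition. -/
def moveDown (d : Layer Γ × Branch Γ × List Γ × Layers Γ) : Layer Γ × Layers Γ :=
  (d.1 ++ d.2.1 :: units d.2.2.1, d.2.2.2)

/-- The movable vertex belongs to the tree. -/
def moveUp (d : Layer Γ × Branch Γ × List Γ × Layers Γ) : Layer Γ × Layers Γ :=
  (d.1 ++ units (d.2.1.leaves ++ d.2.2.1),
    (units d.1.roots ++ d.2.1 :: units d.2.2.1) :: d.2.2.2)

theorem moveDown_injOn (v : List Γ) (j : Γ) : Set.InjOn moveDown (movables v j) := by
  rintro ⟨P, x, c, E⟩ ⟨-, hx, -⟩ ⟨P', x', c', E'⟩ ⟨-, hx', -⟩ h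
  simp only [moveDown, Prod.mk.injEq] at h
  obtain ⟨rfl, rfl, rfl⟩ := append_units_inj hx hx' h.1
  rw [h.2]

theorem moveUp_injOn (v : List Γ) (j : Γ) : Set.InjOn moveUp (movables v j) := by
  rintro ⟨P, x, c, E⟩ ⟨-, hx, -⟩ ⟨P', x', c', E'⟩ ⟨-, hx', -⟩ h
  simp only [moveUp, Prod.mk.injEq, List.cons.injEq] at h
  obtain ⟨-, rfl, rfl⟩ := append_units_inj hx hx' h.2.1
  rw [List.append_cancel_right h.1, h.2.2]

/-- In a common value, `x` would lie to the left of the unary tail over which `x'` sits. Giving `x`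
its own layer would then make the tree contractible at `x`, contrary to membership in `movables`. -/
theorem disjoint_moveDown_moveUp (v : List Γ) (j : Γ) :
    Disjoint (moveDown '' movables v j) (moveUp '' movables v j) := by
  rw [Set.disjoint_left]
  rintro _ ⟨⟨P, x, c, E⟩, ⟨-, hx, -, hd⟩, rfl⟩ ⟨⟨P', x', c', E'⟩, ⟨-, hx', -⟩, h⟩
  simp only [moveUp, moveDown, Prod.mk.injEq] at h hd
  obtain ⟨h1, rfl⟩ := h
  simp only [append_units_cons_mem_OST hx, exists_orderContractibleAt_zero_iff hx hx'] at hd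
  exact hd.2.2 (by simpa using length_lt_of_append_units_eq hx h1.symm)

/-- The last non-degenerate block of the partition moves if its own layer would leave the tree order
reduced; otherwise the lowest non-degenerate vertex of the tree moves down. -/
theorem partitionTrees_eq {v : List Γ} (hv : 2 ≤ v.length) (j : Γ) :
    partitionTrees v j = moveDown '' movables v j ∪ moveUp '' movables v j := by
  ext ⟨π, E⟩
  constructor
  · rintro ⟨⟨hπ, rfl⟩, hE⟩
    simp only at hπ hE hv
    rcases eq_append_units hπ with e | ⟨P, x, c, hx, rfl⟩
    · right
      rw [e, leaves_units] at hv
      generalize roots π = w at *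
      subst e
      -- The partition is the finest one, so the tree has at least two leaves and hence a layer.
      cases E with
      | nil =>
        rw [nil_mem_OST] at hE
        simp [hE] at hv
      | cons L E =>
        obtain ⟨p, x, c, hx, rfl⟩ := exists_of_cons_mem_OST hE
        have h := ((append_units_cons_mem_OST hx).1 hE).1
        refine ⟨⟨units p, x, c, E⟩, ⟨fun b hb => valid_of_mem_units hb, hx, by simpa using h, ?_⟩, ?_⟩
        · simpa [← h] using hE
        · simp [moveUp, ← h]
    · have hP : ∀ b ∈ P, b.Valid := fun b hb => hπ b (by simp [hb])
      by_cases hc : ∃ k, OrderContractibleAt ((units P.roots ++ x :: units c) :: E) 0 k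
      · right
        cases E with
        | nil =>
          obtain ⟨k, hk⟩ := hc
          exact absurd hk (not_orderContractibleAt_singleton _ k)
        | cons M E =>
          obtain ⟨r, y, d, hy, rfl⟩ := exists_of_cons_mem_OST hE
          rw [exists_orderContractibleAt_zero_iff hx hy, length_roots] at hc
          have h := ((append_units_cons_mem_OST hy).1 hE).1
          rw [List.append_assoc] at h
          obtain ⟨h1, h2⟩ := roots_take_of_roots_eq_append h.symm
          generalize hQ : List.drop r.length (P ++ x :: units c) = Q at h2
          have hsplit := List.take_append_drop r.length (P ++ x :: units c)
          -- Contractibility puts `x` before position `r.length`, so `y` and everything to its right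
          -- sit over unary blocks: `y` can be absorbed into the partition.
          have hQ' : Q = units (y.leaves ++ d) := by
            rw [← h2]
            refine eq_units_roots (fun b hb => hπ b ?_) fun b hb => ?_
            · rw [← hQ] at hb
              exact List.mem_of_mem_drop hb
            · rw [← hQ, List.drop_append, List.drop_eq_nil_of_le hc.le, List.nil_append,
                show r.length - P.length = (r.length - P.length - 1) + 1 by omega,
                List.drop_succ_cons] at hb
              exact not_nondegenerate_of_mem_units (List.mem_of_mem_drop hb)
          rw [hQ, hQ'] at hsplit
          refine ⟨⟨(P ++ x :: units c).take r.length, y, d, E⟩,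
            ⟨fun b hb => hπ b (List.mem_of_mem_take hb), hy, ?_, ?_⟩, ?_⟩
          · conv_rhs => rw [← hsplit]
            simp only [leaves_append, leaves_units, List.append_assoc]
          · simp only [h1]
            rwa [List.append_assoc, h]
          · simp only [moveUp, h1, hsplit]
      · left
        refine ⟨⟨P, x, c, E⟩, ⟨hP, hx, by simp, ?_⟩, rfl⟩
        rw [append_units_cons_mem_OST hx]
        exact ⟨rfl, by simpa using hE, hc⟩
  · rintro (⟨⟨P, x, c, E⟩, ⟨hP, hx, h, hd⟩, e⟩ | ⟨⟨P, x, c, E⟩, ⟨hP, hx, h, hd⟩, e⟩) <;>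
      simp only [moveDown, moveUp, Prod.mk.injEq] at e h hd hP hx <;> obtain ⟨rfl, rfl⟩ := e
    · refine ⟨⟨valid_append_units hP hx c, by simpa using h⟩, ?_⟩
      simpa using ((append_units_cons_mem_OST hx).1 hd).2.1
    · refine ⟨⟨fun b hb => ?_, by simpa using h⟩, by simpa using hd⟩
      rcases List.mem_append.1 hb with hb | hb
      exacts [hP b hb, valid_of_mem_units hb]

/-- The signed sum over the order reduced simple trees. -/
def signedSum (v : List Γ) (j : Γ) : H Γ :=
  ∑ᶠ E ∈ OST v j, (-1 : ℂ) ^ numLayers E • Omega E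

/-- A proper layer has at least two leaves, so only the tree without layers is possible. -/
theorem signedSum_singleton (c j : Γ) : signedSum [c] j = Y [c] j := by
  have h : ∀ E ∈ OST [c] j, E = [] := by
    rintro (_ | ⟨L, E⟩) hE
    · rfl
    · obtain ⟨b, hb, hb'⟩ := hE.1.2 L (by simp)
      have e := eq_singleton_of_leaves hE.1.1.1 hE.1.1.2.1
      rw [e, List.mem_singleton] at hb
      simp [hb, Branch.Nondegenerate] at hb'
  by_cases hc : c = j
  · subst hc
    have : OST [c] c = {[]} := Set.eq_singleton_iff_unique_mem.2 ⟨nil_mem_OST.2 rfl, h⟩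
    simp [signedSum, this, Y_self, numLayers, Omega]
  · have : OST [c] j = ∅ := by
      refine Set.eq_empty_of_forall_notMem fun E hE => ?_
      have := h E hE
      subst this
      exact hc (by simpa using nil_mem_OST.1 hE)
    simp [signedSum, this, Y, hc]

theorem antiLift_signedSum {v : List Γ} (hv : v ≠ []) (j : Γ) :
    antiLift (fun g => signedSum g.1.1 g.1.2) (Y v j) = signedSum v j := by
  by_cases h : 2 ≤ v.length
  · rw [Y_of_le h, antiLift_ι]
  · have := List.length_pos_iff.2 hv
    obtain ⟨c, rfl⟩ := List.length_eq_one_iff.1 (show v.length = 1 by omega)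
    rw [signedSum_singleton]
    by_cases hc : c = j
    · subst hc
      rw [Y_self, antiLift_one]
    · simp [Y, hc]

/-! ### The tree formula as the antipode -/

section Finite

variable [Finite Γ]

theorem sum_blockProd_mul_signedSum {v : List Γ} (hv : 2 ≤ v.length) (j : Γ) :
    ∑ π ∈ partitions v, blockProd π * signedSum π.roots j = 0 := by
  have hfin : (partitionTrees v j).Finite := by
    refine ((coloredPartitions_finite v).biUnion fun π _ =>
      (OST_finite π.roots j).image (Prod.mk π)).subset ?_
    rintro ⟨π, E⟩ ⟨h, h'⟩
    exact Set.mem_biUnion h ⟨E, h', rfl⟩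
  have hmov : (movables v j).Finite := by
    refine Set.Finite.of_finite_image (hfin.subset ?_) (moveDown_injOn v j)
    rw [partitionTrees_eq hv]
    exact Set.subset_union_left
  have h1 : ∑ π ∈ partitions v, blockProd π * signedSum π.roots j =
      ∑ᶠ z ∈ partitionTrees v j, blockProd z.1 * ((-1 : ℂ) ^ numLayers z.2 • Omega z.2) := by
    rw [finsum_mem_eq_finite_toFinset_sum _ hfin,
      Finset.sum_finset_product _ (partitions v) fun π => (OST_finite π.roots j).toFinset]
    · refine Finset.sum_congr rfl fun π _ => ?_
      rw [signedSum, finsum_mem_eq_finite_toFinset_sum _ (OST_finite π.roots j), Finset.mul_sum]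
    · intro z
      simp [partitionTrees, coloredPartitions]
  rw [h1, partitionTrees_eq hv, finsum_mem_union (disjoint_moveDown_moveUp v j)
    (hmov.image _) (hmov.image _), finsum_mem_image (moveDown_injOn v j),
    finsum_mem_image (moveUp_injOn v j), ← finsum_mem_add_distrib hmov]
  -- Both members of a pair give `blockProd P * Y x.leaves x.root * Omega E`, with opposite signs.
  refine finsum_mem_eq_zero_of_forall_eq_zero ?_
  rintro ⟨P, x, c, E⟩ ⟨hP, hx, h, hd⟩
  simp only [moveDown, moveUp, Omega_cons (valid_of_cons_mem_OST hd)]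
  simp [numLayers, pow_succ, mul_assoc]

theorem id_conv_antiLift_signedSum :
    WithConv.toConv (LinearMap.id : H Γ →ₗ[ℂ] H Γ) *
      WithConv.toConv (antiLift fun g => signedSum g.1.1 g.1.2) = 1 := by
  refine id_conv_antiLift fun g => ?_
  rw [← sum_blockProd_mul_signedSum g.2 g.1.2]
  refine Finset.sum_congr rfl fun π hπ => ?_
  rw [antiLift_signedSum]
  intro e
  have h := (mem_partitions.1 hπ).2
  have e' : π = [] := by simpa [roots] using e
  have h' := g.2
  rw [← h, e'] at h'
  simp at h'

/-- The recursive left inverse and the explicit right inverse coincide, so the explicit map is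
two-sided; any antipode is a left inverse and therefore equals it. -/
theorem isAntipode_iff_eq {S : H Γ →ₗ[ℂ] H Γ} :
    IsAntipode S ↔ S = antiLift fun g => signedSum g.1.1 g.1.2 := by
  obtain ⟨T, hT⟩ := exists_conv_id_eq_one (Γ := Γ)
  have hR := id_conv_antiLift_signedSum (Γ := Γ)
  rw [isAntipode_iff]
  constructor
  · rintro ⟨h, -⟩
    exact WithConv.toConv_injective (left_inv_eq_right_inv h hR)
  · rintro rfl
    rw [left_inv_eq_right_inv hT hR] at hT
    exact ⟨hT, hR⟩

end Finite

end IntervalHopf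

end

theorem mainTheorem3 {Γ : Type*} [Finite Γ] :
    (∃! S : IntervalHopf.H Γ →ₗ[ℂ] IntervalHopf.H Γ, IntervalHopf.IsAntipode S) ∧
    ∀ S : IntervalHopf.H Γ →ₗ[ℂ] IntervalHopf.H Γ, IntervalHopf.IsAntipode S →
      ∀ (v : List Γ) (j : Γ), v ≠ [] →
        (IntervalHopf.OST v j).Finite ∧
        S (IntervalHopf.Y v j) =
          ∑ᶠ E ∈ IntervalHopf.OST v j,
            (-1 : ℂ) ^ IntervalHopf.numLayers E • IntervalHopf.Omega E := by
  refine ⟨⟨_, IntervalHopf.isAntipode_iff_eq.2 rfl, fun S hS => IntervalHopf.isAntipode_iff_eq.1 hS⟩,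
    fun S hS v j hv => ⟨IntervalHopf.OST_finite v j, ?_⟩⟩
  rw [IntervalHopf.isAntipode_iff_eq.1 hS]
  exact IntervalHopf.antiLift_signedSum hv j
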